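/- Let $\mathbb{X}\subset\mathbb{R}^n$ be compact and let $(X_t)_{t\ge 0}$ be a time-homogeneous reversible Markov process on $\mathbb{X}$ with unique invariant density $\rho$ and with transition densities $p^t_x$ ($t>0$, $x\in\mathbb{X}$) with respect to Lebesgue measure. Let $L^2_{1/\rho}$ be the space of (classes of) functions on $\mathbb{X}$ with norm $\|f\|_{L^2_{1/\rho}}=\big(\int_{\mathbb{X}} f(x)^2\rho(x)^{-1}\,dx\big)^{1/2}<\infty$. Fix a lag time $\tau>0$, $\varepsilon\ge 0$ and $r\in\mathbb{N}_0$. A transition manifold of the process is a set $\mathbb{M}\subset\widetilde{\mathbb{M}}:=\{p^\tau_x \mid x\in\mathbb{X}\}$ of functions in $L^2_{1/\rho}$ which, with the topology of $L^2_{1/\rho}$, is an $r$-dimensional topological manifold (possibly with boundary), and such that for every $x\in\mathbb{X}$ there is $f\in\mathbb{M}$ with $\|f-p^\tau_x\|_{L^2_{1/\rho}}\le\varepsilon$. The process is called $(\varepsilon,r)$-reducible if a transition manifold exists. Let $k\colon\mathbb{X}\times\mathbb{X}\to\mathbb{R}$ be a bounded measurable positive definite kernel (for example a continuous one), $\mathbb{H}$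 its reproducing kernel Hilbert space, $\mu(f)=\int_{\mathbb{X}}k(x,\cdot)f(x)\,dx\in\mathbb{H}$ the kernel mean embedding, and $\lambda_0$ the largest eigenvalue of the integral operator $\mathcal{T}_k f=\int_{\mathbb{X}} k(\cdot,x)f(x)\,dx$ on $L^2(\mathbb{X})$. Assume that $k$ is characteristic, i.e. that $\mu$ is injective on (classes of) probability densities on $\mathbb{X}$, and that $X_t$ is $(\varepsilon,r)$-reducible. Then for every transition manifold $\mathbb{M}$: 1. If $\mathbb{M}$ is relatively compact in $L^2_{1/\rho}$ (for example if $\mathbb{M}$ is compact, or if $x\mapsto p^\tau_x\in L^2_{1/\rho}$ is continuous on the compact space $\mathbb{X}$), then $\mu(\mathbb{M})$, with the topology of $\mathbb{H}$, is an $r$-dimensional topological manifold; it is one without boundary if $\mathbb{M}$ is. 2. For all $x\in\mathbb{X}$, $$\inf_{g\in\mu(\mathbb{M})}\|g-\mu(p^\tau_x)\|_{\mathbb{H}}\le\sqrt{\lambda_0}\,\|\sqrt{\rho}\|_\infty\,\varepsilon ,$$ where $\|\cdot\|_\infty$ denotes the essential supremum (the right-hand side being read in $[0,\infty]$ with $0\cdot\infty=0$).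 -/

import Mathlib

open MeasureTheory ProbabilityTheory
open scoped NNReal ENNReal

noncomputable section

namespace TransitionManifold

/-! ### Markov processes, invariant densities, transition densities -/

/-- A time-homogeneous Markov process with state space `S` on the sample space `Ω`, given as a
family of laws `law x` (the process started in `x`). -/
structure MarkovProcess (S : Type*) [MeasurableSpace S] (Ω : Type*) [MeasurableSpace Ω] where
  /-- the random variables `X_t` -/
  path : ℝ≥0 → Ω → S
  /-- the law of the process started in `x` -/
  law : Kernel S Ω
  isMarkovKernel_law : IsMarkovKernel law
  measurable_path : ∀ t, Measurable (path t)
  start : ∀ x, ∀ᵐ ω ∂law x, path 0 ω = x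
  /-- the Markov property with respect to the filtration generated by the process -/
  markov : ∀ (x : S) (s t : ℝ≥0) (B : Set Ω),
    MeasurableSet[⨆ u ∈ Set.Iic s, MeasurableSpace.comap (path u) inferInstance] B →
    ∀ A : Set S, MeasurableSet A →
      law x (B ∩ path (s + t) ⁻¹' A) = ∫⁻ ω in B, law (path s ω) (path t ⁻¹' A) ∂law x

/-- Probability densities with respect to the reference measure `volume`. -/
structure IsProbDensity {S : Type*} [MeasureSpace S] (f : S → ℝ) : Prop where
  measurable : Measurable f
  nonneg : ∀ x, 0 ≤ f x
  lintegral_eq_one : ∫⁻ x, ENNReal.ofReal (f x) = 1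

/-- The measure with density `f` with respect to `volume`. -/
def densityMeasure {S : Type*} [MeasureSpace S] (f : S → ℝ) : Measure S :=
  (volume : Measure S).withDensity fun x => ENNReal.ofReal (f x)

section Markov

variable {S : Type*} [MeasureSpace S] {Ω : Type*} [MeasurableSpace Ω]

/-- `σ` is an invariant density: if `X_0 ∼ σ` then `X_t ∼ σ` for all `t ≥ 0`. -/
def IsInvariantDensity (P : MarkovProcess S Ω) (σ : S → ℝ) : Prop :=
  IsProbDensity σ ∧ ∀ (t : ℝ≥0) (A : Set S), MeasurableSet A →
    ∫⁻ x, P.law x (P.path t ⁻¹' A) ∂densityMeasure σ = densityMeasure σ A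

/-- Reversibility (detailed balance): if `X_0 ∼ ρ`, then `(X_0, X_t)` and `(X_t, X_0)` have the
same law. -/
def IsReversible (P : MarkovProcess S Ω) (ρ : S → ℝ) : Prop :=
  ∀ (t : ℝ≥0) (A B : Set S), MeasurableSet A → MeasurableSet B →
    ∫⁻ x in A, P.law x (P.path t ⁻¹' B) ∂densityMeasure ρ =
      ∫⁻ x in B, P.law x (P.path t ⁻¹' A) ∂densityMeasure ρ

/-- The process is reversible and `ρ` is its unique invariant density. -/
structure IsReversibleWithUniqueDensity (P : MarkovProcess S Ω) (ρ : S → ℝ) : Prop where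
  invariant : IsInvariantDensity P ρ
  reversible : IsReversible P ρ
  unique : ∀ σ, IsInvariantDensity P σ → σ =ᵐ[volume] ρ

/-- `p t x` is the density of `X_t`, `t > 0`, for the process started in `x`. -/
def HasTransitionDensity (P : MarkovProcess S Ω) (p : ℝ≥0 → S → S → ℝ) : Prop :=
  ∀ t : ℝ≥0, 0 < t → ∀ x : S, Measurable (p t x) ∧ (∀ y, 0 ≤ p t x y) ∧
    (P.law x).map (P.path t) = densityMeasure (p t x)

end Markov

/-! ### Topological manifolds -/

/-- The closed half-space in `ℝ^r` (a point if `r = 0`). -/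
abbrev HalfSpace (r : ℕ) : Type :=
  {v : EuclideanSpace ℝ (Fin r) // ∀ i : Fin r, (i : ℕ) = 0 → 0 ≤ v i}

/-- The set `A`, with the subspace topology, is an `r`-dimensional topological manifold, possibly
with boundary. -/
def IsManifoldOfDim {E : Type*} [TopologicalSpace E] (r : ℕ) (A : Set E) : Prop :=
  T2Space A ∧ SecondCountableTopology A ∧ Nonempty (ChartedSpace (HalfSpace r) A)

/-- The set `A`, with the subspace topology, is an `r`-dimensional topological manifold without
boundary. -/
def IsBoundarylessManifoldOfDim {E : Type*} [TopologicalSpace E] (r : ℕ) (A : Set E) : Prop :=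
  T2Space A ∧ SecondCountableTopology A ∧
    Nonempty (ChartedSpace (EuclideanSpace ℝ (Fin r)) A)

/-! ### Reducibility -/

section Reducibility

variable {S : Type*} [MeasureSpace S]

/-- The measure `dx / ρ(x)`; the quotient is taken in `[0, ∞]`, hence it is `∞` where `ρ = 0`. -/
def invDensityMeasure (ρ : S → ℝ) : Measure S :=
  (volume : Measure S).withDensity fun x => (ENNReal.ofReal (ρ x))⁻¹

/-- The weighted space `L²_{1/ρ}`. -/
abbrev L2inv (ρ : S → ℝ) : Type _ := Lp ℝ 2 (invDensityMeasure ρ)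

/-- The fuzzy transition manifold `{p^τ_x | x}`, as a set of classes in `L²_{1/ρ}`. -/
def fuzzyTransitionManifold (ρ : S → ℝ) (p : ℝ≥0 → S → S → ℝ) (τ : ℝ≥0) : Set (L2inv ρ) :=
  {f | ∃ x, f =ᵐ[volume] p τ x}

/-- `M` is an `r`-dimensional transition manifold at lag time `τ`, with accuracy `ε`. The
inequality includes that every `p^τ_x` lies in `L²_{1/ρ}`. -/
structure IsTransitionManifold (ρ : S → ℝ) (p : ℝ≥0 → S → S → ℝ) (τ ε : ℝ≥0) (r : ℕ)
    (M : Set (L2inv ρ)) : Prop where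
  isManifold : IsManifoldOfDim r M
  subset : M ⊆ fuzzyTransitionManifold ρ p τ
  close : ∀ x, ∃ f ∈ M, eLpNorm (fun y => f y - p τ x y) 2 (invDensityMeasure ρ) ≤ ε

/-- `(ε, r)`-reducibility at lag time `τ`. -/
def IsReducible (ρ : S → ℝ) (p : ℝ≥0 → S → S → ℝ) (τ ε : ℝ≥0) (r : ℕ) : Prop :=
  ∃ M : Set (L2inv ρ), IsTransitionManifold ρ p τ ε r M

end Reducibility

/-! ### Kernels and the kernel mean embedding -/

section Kernel

variable {S : Type*}

/-- Positive definite kernels (in the customary weak sense). -/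
def IsPosDefKernel (k : S → S → ℝ) : Prop :=
  (∀ x y, k x y = k y x) ∧
    ∀ (s : Finset S) (c : S → ℝ), 0 ≤ ∑ x ∈ s, ∑ y ∈ s, c x * c y * k x y

/-- The Hilbert space of functions `H` has the reproducing kernel `k`. -/
def HasKernel (H : Type*) [NormedAddCommGroup H] [InnerProductSpace ℝ H] [CompleteSpace H]
    [RKHS ℝ H S ℝ] (k : S → S → ℝ) : Prop :=
  ∀ x y, RKHS.kerFun H x (1 : ℝ) y = k x y

variable [MeasureSpace S] (H : Type*) [NormedAddCommGroup H] [InnerProductSpace ℝ H]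
  [RKHS ℝ H S ℝ]

open Classical in
/-- The kernel mean embedding `μ(f) = ∫ k(x, ·) f(x) dx`: the element of `H` that is, as a
function, `y ↦ ∫ k(x, y) f(x) dx`. -/
def meanEmbedding (k : S → S → ℝ) (f : S → ℝ) : H :=
  if h : ∃ g : H, ∀ y, g y = ∫ x, k x y * f x then h.choose else 0

/-- The kernel is characteristic: the kernel mean embedding is injective on probability
densities (up to equality almost everywhere). -/
def IsCharacteristic (k : S → S → ℝ) : Prop :=
  ∀ f g : S → ℝ, IsProbDensity f → IsProbDensity g →
    meanEmbedding H k f = meanEmbedding H k g → f =ᵐ[volume] g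

/-- The eigenvalues of the integral operator `T_k φ = ∫ k(·, y) φ(y) dy` on `L²`. -/
def mercerEigenvalues (k : S → S → ℝ) : Set ℝ :=
  {l | ∃ φ : Lp ℝ 2 (volume : Measure S), φ ≠ 0 ∧ ∀ᵐ x, ∫ y, k x y * φ y = l * φ x}

/-- The largest Mercer eigenvalue `λ₀`. -/
def mercerTop (k : S → S → ℝ) : ℝ := sSup (mercerEigenvalues k)

end Kernel

end TransitionManifold

end

open TransitionManifold

-- Lebesgue measure on a subset of Euclidean space
attribute [local instance] MeasureTheory.Measure.Subtype.measureSpace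

/-! Let `J` be the inclusion of `H` into `L²`. The reproducing property makes integration against
`f` the functional represented by `μ(f)`; hence `μ = J†` on `L²`, and `J J†` is the integral
operator.

Distance bound: `‖J† ·‖` is weakly sequentially continuous on the unit ball, so it attains its
maximum `‖J‖` there, and a maximiser is an eigenvector of `J J†` for `‖J‖²` (`norm_inclusionL2_le`).
Thus `‖J†‖ ≤ √λ₀`, while `ρ ≤ ‖√ρ‖_∞²` a.e. compares the `L²` norm with that of `L²_{1/ρ}`.

Manifold: since `∫ ρ = 1`, Cauchy–Schwarz embeds `L²_{1/ρ}` contractively into `L¹`, where a bounded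
kernel makes `μ` Lipschitz, even for unbounded `ρ`. Probability densities form a closed set, so `μ`
is injective on the compact closure of `M`, and a continuous injection of a compact space into a
Hausdorff one is an embedding (`nonempty_homeomorph_image`). The charts are then transported. -/

namespace TransitionManifold

open Filter Topology InnerProductSpace

/-! ### Operators attaining their norm -/

section NormAttained

variable {E F : Type*} [NormedAddCommGroup E] [InnerProductSpace ℝ E] [CompleteSpace E]
  [NormedAddCommGroup F] [InnerProductSpace ℝ F]

/-- Bounded sequences in a separable Hilbert space have weakly convergent subsequences. -/
theorem exists_weakly_tendsto_subseq [TopologicalSpace.SeparableSpace E] (u : ℕ → E)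
    (hu : ∀ n, ‖u n‖ ≤ 1) :
    ∃ (v : E) (φ : ℕ → ℕ), StrictMono φ ∧ ‖v‖ ≤ 1 ∧
      ∀ w, Tendsto (fun n => ⟪u (φ n), w⟫_ℝ) atTop (𝓝 ⟪v, w⟫_ℝ) := by
  have hc := WeakDual.isSeqCompact_closedBall ℝ E (0 : StrongDual ℝ E) 1
  let d : ℕ → WeakDual ℝ E := fun n => StrongDual.toWeakDual (toDual ℝ E (u n))
  obtain ⟨a, ha, φ, hφ, hlim⟩ := hc (x := d) fun n => by
    change toDual ℝ E (u n) ∈ Metric.closedBall (0 : StrongDual ℝ E) 1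
    simpa using hu n
  refine ⟨(toDual ℝ E).symm (WeakDual.toStrongDual a), φ, hφ, ?_, fun w => ?_⟩
  · rw [LinearIsometryEquiv.norm_map]
    simpa using ha
  · rw [toDual_symm_apply]
    exact ((WeakDual.eval_continuous w).tendsto a).comp hlim

/-- A vector at which an operator attains its norm is an eigenvector of `A† A`. -/
theorem adjoint_comp_self_eq_of_norm_attained [CompleteSpace F] (A : E →L[ℝ] F) {v : E} (hv : ‖v‖ ≤ 1)
    (hA : ‖A v‖ = ‖A‖) : A.adjoint (A v) = ‖A‖ ^ 2 • v := by
  rw [← sub_eq_zero, ← norm_eq_zero, ← sq_eq_zero_iff]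
  refine le_antisymm ?_ (sq_nonneg _)
  have h1 : ‖A.adjoint (A v)‖ ≤ ‖A‖ ^ 2 := by
    calc ‖A.adjoint (A v)‖ ≤ ‖A.adjoint‖ * ‖A v‖ := ContinuousLinearMap.le_opNorm _ _
      _ = ‖A‖ ^ 2 := by rw [LinearIsometryEquiv.norm_map, hA, sq]
  have h2 : ⟪A.adjoint (A v), v⟫_ℝ = ‖A‖ ^ 2 := by
    rw [ContinuousLinearMap.adjoint_inner_left, real_inner_self_eq_norm_sq, hA]
  have h3 : ‖A.adjoint (A v)‖ ^ 2 ≤ (‖A‖ ^ 2) ^ 2 := by gcongr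
  have h4 : ‖v‖ ^ 2 ≤ 1 := pow_le_one₀ (norm_nonneg _) hv
  -- Expanding the square gives `‖A†Av‖² - 2‖A‖⁴ + ‖A‖⁴‖v‖²`, which `h3` and `h4` bound by `0`.
  rw [norm_sub_sq_real, inner_smul_right, h2, norm_smul, mul_pow, Real.norm_of_nonneg (sq_nonneg _)]
  nlinarith [sq_nonneg (‖A‖ ^ 2)]

/-- An operator for which `‖A ·‖` is weakly sequentially continuous on the unit ball attains its
norm. -/
theorem exists_norm_attained [TopologicalSpace.SeparableSpace E] (A : E →L[ℝ] F)
    (hA : ∀ (u : ℕ → E) (v : E), (∀ n, ‖u n‖ ≤ 1) →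
      (∀ w, Tendsto (fun n => ⟪u n, w⟫_ℝ) atTop (𝓝 ⟪v, w⟫_ℝ)) →
      Tendsto (fun n => ‖A (u n)‖) atTop (𝓝 ‖A v‖)) :
    ∃ v, ‖v‖ ≤ 1 ∧ ‖A v‖ = ‖A‖ := by
  have hex : ∀ n : ℕ, ∃ x : E, ‖x‖ ≤ 1 ∧ ‖A‖ - 1 / ((n : ℝ) + 1) ≤ ‖A x‖ := by
    intro n
    have hpos : (0 : ℝ) < 1 / ((n : ℝ) + 1) := by positivity
    by_cases h : ‖A‖ - 1 / ((n : ℝ) + 1) < 0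
    · exact ⟨0, by simp, by simpa using h.le⟩
    · obtain ⟨x, hx, hAx⟩ := A.exists_lt_apply_of_lt_opNorm (r := ‖A‖ - 1 / ((n : ℝ) + 1))
        (by linarith)
      exact ⟨x, hx.le, hAx.le⟩
  choose u hu hAu using hex
  obtain ⟨v, φ, hφ, hv, hw⟩ := exists_weakly_tendsto_subseq u hu
  have hle : ‖A v‖ ≤ ‖A‖ :=
    (A.le_opNorm v).trans (mul_le_of_le_one_right (norm_nonneg _) hv)
  refine ⟨v, hv, le_antisymm hle ?_⟩
  have hlim := hA (u ∘ φ) v (fun n => hu _) hw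
  have h0 : Tendsto (fun n : ℕ => ‖A‖ - 1 / (((φ n : ℕ) : ℝ) + 1)) atTop (𝓝 (‖A‖ - 0)) :=
    tendsto_const_nhds.sub (tendsto_one_div_add_atTop_nhds_zero_nat.comp hφ.tendsto_atTop)
  rw [sub_zero] at h0
  exact le_of_tendsto_of_tendsto' h0 hlim fun n => hAu _

end NormAttained

/-! ### Functions in a reproducing kernel Hilbert space -/

section RKHSFunctions

variable {S : Type*} {H : Type*} [NormedAddCommGroup H] [InnerProductSpace ℝ H] [CompleteSpace H]
  [RKHS ℝ H S ℝ] {k : S → S → ℝ}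

theorem HasKernel.kerFun_inner_kerFun (hH : HasKernel H k) (x y : S) :
    ⟪RKHS.kerFun H x (1 : ℝ), RKHS.kerFun H y (1 : ℝ)⟫_ℝ = k x y := by
  rw [RKHS.inner_kerFun, hH x y]
  simp

theorem HasKernel.symm (hH : HasKernel H k) (x y : S) : k x y = k y x := by
  rw [← hH.kerFun_inner_kerFun, ← hH.kerFun_inner_kerFun, real_inner_comm]

theorem kerFun_one_inner (x : S) (h : H) : ⟪RKHS.kerFun H x (1 : ℝ), h⟫_ℝ = h x := by
  rw [RKHS.kerFun_inner]
  simp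

/-- Cauchy–Schwarz against the kernel section at `x`, whose norm is `√(k x x)`. -/
theorem HasKernel.abs_apply_le (hH : HasKernel H k) {C : ℝ} (hC : ∀ x, k x x ≤ C) (h : H) (x : S) :
    |h x| ≤ √C * ‖h‖ := by
  rw [← kerFun_one_inner x h]
  refine (abs_real_inner_le_norm _ _).trans ?_
  gcongr
  rw [norm_eq_sqrt_real_inner, hH.kerFun_inner_kerFun]
  exact Real.sqrt_le_sqrt (hC x)

/-- If the kernel is measurable, then so are all functions in its reproducing kernel Hilbert
space. -/
theorem HasKernel.measurable [MeasurableSpace S] (hH : HasKernel H k)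
    (hk : ∀ x, Measurable (k x)) (h : H) : Measurable h := by
  let V : Submodule ℝ H :=
    { carrier := {g | Measurable g}
      add_mem' := fun {a b} ha hb => by
        have := Measurable.add ha hb
        simpa [Set.mem_ofPred_eq, RKHS.coe_add] using this
      zero_mem' := by
        simpa [Set.mem_ofPred_eq, RKHS.coe_zero] using (measurable_zero : Measurable (0 : S → ℝ))
      smul_mem' := fun c a ha => by
        have := Measurable.const_smul ha c
        simpa [Set.mem_ofPred_eq, RKHS.coe_smul] using this }
  -- Norm convergence in `H` implies pointwise convergence, so measurability passes to limits; the
  -- kernel sections span a dense subspace.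
  have hcl : IsClosed (V : Set H) := by
    refine IsSeqClosed.isClosed fun u g hu hg => ?_
    refine measurable_of_tendsto_metrizable (f := fun n => ⇑(u n)) hu ?_
    rw [tendsto_pi_nhds]
    exact fun x => ((RKHS.continuous_eval x).tendsto g).comp hg
  have hspan : Submodule.span ℝ {RKHS.kerFun H x v | (x : S) (v : ℝ)} ≤ V := by
    rw [Submodule.span_le]
    rintro _ ⟨x, v, rfl⟩
    have hx : RKHS.kerFun H x v = v • RKHS.kerFun H x (1 : ℝ) := by
      rw [← map_smul]; simp
    rw [hx]
    refine V.smul_mem v ?_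
    have : ⇑(RKHS.kerFun H x (1 : ℝ)) = k x := funext (hH x)
    change Measurable ⇑(RKHS.kerFun H x (1 : ℝ))
    rw [this]
    exact hk x
  have htop : h ∈ (Submodule.span ℝ {RKHS.kerFun H x v | (x : S) (v : ℝ)}).topologicalClosure := by
    rw [RKHS.kerFun_dense]; trivial
  exact Submodule.topologicalClosure_minimal _ hspan hcl htop

end RKHSFunctions

/-! ### The kernel mean embedding -/

section MeanEmbedding

variable {S : Type*} [MeasureSpace S] {H : Type*} [NormedAddCommGroup H] [InnerProductSpace ℝ H]
  [RKHS ℝ H S ℝ] {k : S → S → ℝ}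

theorem meanEmbedding_congr_ae {f g : S → ℝ} (hfg : f =ᵐ[volume] g) :
    meanEmbedding H k f = meanEmbedding H k g := by
  have : ∀ y, ∫ x, k x y * f x = ∫ x, k x y * g x := fun y =>
    integral_congr_ae (hfg.mono fun x hx => by simp only [hx])
  -- The chosen element depends only on the function `F`, whether or not a representative exists, so
  -- no integrability is needed.
  have key : ∀ {F G : S → ℝ}, F = G →
      (open Classical in if h : ∃ g : H, ∀ y, g y = F y then h.choose else 0) =
        (open Classical in if h : ∃ g : H, ∀ y, g y = G y then h.choose else 0) := by
    rintro F G rfl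
    rfl
  exact key (funext this)

theorem integrable_apply_mul {C : ℝ} (hm : ∀ h : H, Measurable h)
    (hb : ∀ (h : H) x, |h x| ≤ C * ‖h‖) {f : S → ℝ} (hf : Integrable f) (h : H) :
    Integrable fun x => h x * f x :=
  hf.bdd_mul (hm h).aestronglyMeasurable (Eventually.of_forall fun x => hb h x)

theorem abs_integral_apply_mul_le {C : ℝ} (hm : ∀ h : H, Measurable h)
    (hb : ∀ (h : H) x, |h x| ≤ C * ‖h‖) {f : S → ℝ} (hf : Integrable f) (h : H) :
    |∫ x, h x * f x| ≤ C * (∫ x, |f x|) * ‖h‖ := by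
  calc |∫ x, h x * f x| ≤ ∫ x, |h x * f x| := abs_integral_le_integral_abs
    _ ≤ ∫ x, C * ‖h‖ * |f x| := by
      refine integral_mono (integrable_apply_mul hm hb hf h).abs (hf.abs.const_mul _) fun x => ?_
      change |h x * f x| ≤ C * ‖h‖ * |f x|
      rw [abs_mul]
      gcongr
      exact hb h x
    _ = C * (∫ x, |f x|) * ‖h‖ := by rw [integral_const_mul]; ring

variable [CompleteSpace H]

/-- Riesz representation. Evaluating `g` through kernel sections shows that the default value `0` in
`meanEmbedding` is not used for integrable `f`. -/
theorem exists_inner_eq_integral {C : ℝ} (hm : ∀ h : H, Measurable h)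
    (hb : ∀ (h : H) x, |h x| ≤ C * ‖h‖) {f : S → ℝ} (hf : Integrable f) :
    ∃ g : H, ∀ h : H, ⟪g, h⟫_ℝ = ∫ x, h x * f x := by
  let L : H →ₗ[ℝ] ℝ :=
    { toFun := fun h => ∫ x, h x * f x
      map_add' := fun a b => by
        rw [← integral_add (integrable_apply_mul hm hb hf a) (integrable_apply_mul hm hb hf b)]
        simp [add_mul]
      map_smul' := fun c a => by
        simp [mul_assoc, integral_const_mul] }
  let L' : StrongDual ℝ H := L.mkContinuous (C * ∫ x, |f x|) fun h => by
    exact abs_integral_apply_mul_le hm hb hf h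
  exact ⟨(toDual ℝ H).symm L', fun h => by rw [toDual_symm_apply]; rfl⟩

/-- The mean embedding of `f` is the Riesz representative of integration against `f`. -/
theorem inner_meanEmbedding {C : ℝ} (hH : HasKernel H k) (hm : ∀ h : H, Measurable h)
    (hb : ∀ (h : H) x, |h x| ≤ C * ‖h‖) {f : S → ℝ} (hf : Integrable f) (h : H) :
    ⟪meanEmbedding H k f, h⟫_ℝ = ∫ x, h x * f x := by
  obtain ⟨g, hg⟩ := exists_inner_eq_integral hm hb hf
  have hgy : ∀ y, g y = ∫ x, k x y * f x := fun y => by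
    rw [← kerFun_one_inner y g, real_inner_comm, hg]
    simp only [hH y, hH.symm y]
  have hex : ∃ g : H, ∀ y, g y = ∫ x, k x y * f x := ⟨g, hgy⟩
  have : meanEmbedding H k f = g := by
    rw [meanEmbedding, dif_pos hex]
    exact RKHS.ext fun y => by rw [hex.choose_spec y, hgy y]
  rw [this, hg]

/-- Pair the difference `v` with itself: `‖v‖² = ∫ v (f - g) ≤ C ‖f - g‖₁ ‖v‖`, then divide by
`‖v‖`. -/
theorem norm_meanEmbedding_sub_le {C : ℝ} (hC : 0 ≤ C) (hH : HasKernel H k) (hm : ∀ h : H, Measurable h)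
    (hb : ∀ (h : H) x, |h x| ≤ C * ‖h‖) {f g : S → ℝ} (hf : Integrable f) (hg : Integrable g) :
    ‖meanEmbedding H k f - meanEmbedding H k g‖ ≤ C * ∫ x, |f x - g x| := by
  set v := meanEmbedding H k f - meanEmbedding H k g with hv
  by_cases hv0 : ‖v‖ = 0
  · rw [hv0]
    exact mul_nonneg hC (integral_nonneg fun _ => abs_nonneg _)
  · have h1 : ‖v‖ ^ 2 = ∫ x, v x * (f x - g x) := by
      rw [← real_inner_self_eq_norm_sq]
      nth_rewrite 1 [hv]
      rw [inner_sub_left, inner_meanEmbedding hH hm hb hf, inner_meanEmbedding hH hm hb hg,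
        ← integral_sub (integrable_apply_mul hm hb hf v) (integrable_apply_mul hm hb hg v)]
      simp only [mul_sub]
    have h2 := (le_abs_self _).trans (abs_integral_apply_mul_le hm hb (hf.sub hg) v)
    simp only [Pi.sub_apply] at h2
    rw [← h1, sq] at h2
    exact le_of_mul_le_mul_right h2 (lt_of_le_of_ne (norm_nonneg _) (Ne.symm hv0))

end MeanEmbedding

/-! ### The integral operator and its largest eigenvalue -/

section Mercer

variable {S : Type*} [MeasureSpace S] [IsFiniteMeasure (volume : Measure S)]
  {H : Type*} [NormedAddCommGroup H] [InnerProductSpace ℝ H]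
  [RKHS ℝ H S ℝ] {k : S → S → ℝ} {C : ℝ}

theorem memLp_apply (hm : ∀ h : H, Measurable h) (hb : ∀ (h : H) x, |h x| ≤ C * ‖h‖) (h : H) :
    MemLp h 2 (volume : Measure S) :=
  MemLp.of_bound (hm h).aestronglyMeasurable (C * ‖h‖) (Eventually.of_forall fun x => hb h x)

/-- The inclusion of a reproducing kernel Hilbert space of bounded functions into `L²`. -/
noncomputable def inclusionL2 (hm : ∀ h : H, Measurable h) (hb : ∀ (h : H) x, |h x| ≤ C * ‖h‖) :
    H →L[ℝ] Lp ℝ 2 (volume : Measure S) :=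
  LinearMap.mkContinuous
    { toFun := fun h => (memLp_apply hm hb h).toLp h
      map_add' := fun a b => by
        rw [← MemLp.toLp_add]
        exact MemLp.toLp_congr _ _ (by simp)
      map_smul' := fun c a => by
        rw [RingHom.id_apply, ← MemLp.toLp_const_smul]
        exact MemLp.toLp_congr _ _ (by simp) }
    -- A function bounded by `|C| ‖h‖` has `L²` norm at most `vol(S)^{1/2} |C| ‖h‖`; the sign of `C`
    -- is not assumed.
    (measureUnivNNReal (volume : Measure S) ^ (2 : ℝ≥0∞).toReal⁻¹ * |C|) fun h => by
      rw [mul_assoc]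
      refine Lp.norm_le_of_ae_bound (by positivity) ?_
      filter_upwards [(memLp_apply hm hb h).coeFn_toLp] with x hx
      change ‖(memLp_apply hm hb h).toLp h x‖ ≤ _
      rw [hx]
      exact (hb h x).trans (mul_le_mul_of_nonneg_right (le_abs_self C) (norm_nonneg _))

theorem coeFn_inclusionL2 (hm : ∀ h : H, Measurable h) (hb : ∀ (h : H) x, |h x| ≤ C * ‖h‖) (h : H) :
    inclusionL2 hm hb h =ᵐ[volume] h :=
  MemLp.coeFn_toLp (memLp_apply hm hb h)

theorem inner_inclusionL2 (hm : ∀ h : H, Measurable h) (hb : ∀ (h : H) x, |h x| ≤ C * ‖h‖) (h : H)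
    {f : S → ℝ} {φ : Lp ℝ 2 (volume : Measure S)} (hφ : φ =ᵐ[volume] f) :
    ⟪inclusionL2 hm hb h, φ⟫_ℝ = ∫ x, h x * f x := by
  rw [L2.inner_def]
  refine integral_congr_ae ?_
  filter_upwards [coeFn_inclusionL2 hm hb h, hφ] with x hx hx'
  rw [hx, hx']
  simp [mul_comm]

variable [CompleteSpace H]

theorem adjoint_inclusionL2_apply (hH : HasKernel H k) (hm : ∀ h : H, Measurable h)
    (hb : ∀ (h : H) x, |h x| ≤ C * ‖h‖) (φ : Lp ℝ 2 (volume : Measure S)) (x : S) :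
    (inclusionL2 hm hb).adjoint φ x = ∫ y, k x y * φ y := by
  rw [← kerFun_one_inner x, ContinuousLinearMap.adjoint_inner_right,
    inner_inclusionL2 hm hb _ EventuallyEq.rfl]
  simp only [hH x]

theorem meanEmbedding_eq_adjoint_inclusionL2 (hH : HasKernel H k) (hm : ∀ h : H, Measurable h)
    (hb : ∀ (h : H) x, |h x| ≤ C * ‖h‖) {f : S → ℝ} (hf : MemLp f 2 (volume : Measure S)) :
    meanEmbedding H k f = (inclusionL2 hm hb).adjoint (hf.toLp f) := by
  refine ext_inner_right ℝ fun h => ?_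
  rw [inner_meanEmbedding hH hm hb (hf.integrable one_le_two),
    ContinuousLinearMap.adjoint_inner_left, real_inner_comm,
    inner_inclusionL2 hm hb h hf.coeFn_toLp]

/-- `‖J† ·‖` is weakly sequentially continuous for the inclusion `J` into `L²`. -/
theorem tendsto_norm_adjoint_inclusionL2 (hm : ∀ h : H, Measurable h)
    (hb : ∀ (h : H) x, |h x| ≤ C * ‖h‖) (u : ℕ → Lp ℝ 2 (volume : Measure S))
    (v : Lp ℝ 2 (volume : Measure S)) (hu : ∀ n, ‖u n‖ ≤ 1)
    (hw : ∀ w, Tendsto (fun n => ⟪u n, w⟫_ℝ) atTop (𝓝 ⟪v, w⟫_ℝ)) :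
    Tendsto (fun n => ‖(inclusionL2 hm hb).adjoint (u n)‖) atTop
      (𝓝 ‖(inclusionL2 hm hb).adjoint v‖) := by
  set J := inclusionL2 hm hb with hJ
  -- Weak convergence tested against `J` of a kernel section is pointwise convergence of `J† uₙ`.
  have hpt : ∀ x, Tendsto (fun n => J.adjoint (u n) x) atTop (𝓝 (J.adjoint v x)) := fun x => by
    simp only [← kerFun_one_inner x, ContinuousLinearMap.adjoint_inner_right]
    simpa only [real_inner_comm] using hw (J (RKHS.kerFun H x (1 : ℝ)))
  have hbd : ∀ n x, |J.adjoint (u n) x| ≤ |C| * ‖J‖ := fun n x => by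
    refine (hb _ x).trans ?_
    refine (mul_le_mul_of_nonneg_right (le_abs_self C) (norm_nonneg _)).trans ?_
    gcongr
    refine (J.adjoint.le_opNorm _).trans ?_
    rw [LinearIsometryEquiv.norm_map]
    exact mul_le_of_le_one_right (norm_nonneg _) (hu n)
  have hvb : ∀ x, |J.adjoint v x| ≤ |C| * ‖J‖ := fun x =>
    le_of_tendsto (hpt x).abs (Eventually.of_forall fun n => hbd n x)
  -- Pointwise convergence with a uniform bound on a finite measure space upgrades to `L²`
  -- convergence.
  have hstrong : Tendsto (fun n => ‖J (J.adjoint (u n) - J.adjoint v)‖ ^ 2) atTop (𝓝 0) := by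
    have hI : ∀ n, ‖J (J.adjoint (u n) - J.adjoint v)‖ ^ 2 =
        ∫ x, (J.adjoint (u n) x - J.adjoint v x) * (J.adjoint (u n) x - J.adjoint v x) := fun n => by
      rw [← real_inner_self_eq_norm_sq, hJ,
        inner_inclusionL2 hm hb _ (coeFn_inclusionL2 hm hb _)]
      simp
    simp only [hI]
    have : (0 : ℝ) = ∫ x : S, (0 : ℝ) := by simp
    rw [this]
    refine tendsto_integral_of_dominated_convergence
      (fun _ => (2 * (|C| * ‖J‖)) * (2 * (|C| * ‖J‖))) (fun n => ?_) (integrable_const _)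
      (fun n => Eventually.of_forall fun x => ?_) (Eventually.of_forall fun x => ?_)
    · exact (((hm _).sub (hm _)).mul ((hm _).sub (hm _))).aestronglyMeasurable
    · have h1 : |J.adjoint (u n) x - J.adjoint v x| ≤ 2 * (|C| * ‖J‖) := by
        refine (abs_sub _ _).trans ?_
        linarith [hbd n x, hvb x]
      rw [norm_mul]
      exact mul_le_mul h1 h1 (norm_nonneg _) (by positivity)
    · have := (hpt x).sub_const (J.adjoint v x)
      rw [sub_self] at this
      simpa using this.mul this
  have hstrong' : Tendsto (fun n => ‖J (J.adjoint (u n) - J.adjoint v)‖) atTop (𝓝 0) := by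
    simpa using hstrong.sqrt
  have hsq : Tendsto (fun n => ‖J.adjoint (u n)‖ ^ 2) atTop (𝓝 (‖J.adjoint v‖ ^ 2)) := by
    -- In `‖J† uₙ‖² = ⟪uₙ, J J† uₙ⟫`, the first summand vanishes by strong convergence and the
    -- second converges by weak convergence.
    have hsplit : ∀ n, ‖J.adjoint (u n)‖ ^ 2 =
        ⟪u n, J (J.adjoint (u n) - J.adjoint v)⟫_ℝ + ⟪u n, J (J.adjoint v)⟫_ℝ := fun n => by
      rw [← inner_add_right, ← map_add, sub_add_cancel, ← real_inner_self_eq_norm_sq,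
        ContinuousLinearMap.adjoint_inner_left]
    have h2 : ‖J.adjoint v‖ ^ 2 = 0 + ⟪v, J (J.adjoint v)⟫_ℝ := by
      rw [zero_add, ← real_inner_self_eq_norm_sq, ContinuousLinearMap.adjoint_inner_left]
    simp only [hsplit, h2]
    refine Tendsto.add (squeeze_zero_norm (fun n => ?_) hstrong') (hw _)
    refine (abs_real_inner_le_norm _ _).trans ?_
    exact mul_le_of_le_one_left (norm_nonneg _) (hu n)
  simpa using hsq.sqrt

/-- The norm of the inclusion into `L²` is bounded by the square root of the largest eigenvalue of
the integral operator. -/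
theorem norm_inclusionL2_le [MeasurableSpace.CountablyGenerated S] (hH : HasKernel H k)
    (hm : ∀ h : H, Measurable h) (hb : ∀ (h : H) x, |h x| ≤ C * ‖h‖) :
    ‖inclusionL2 hm hb‖ ≤ √(mercerTop k) := by
  set J := inclusionL2 hm hb with hJ
  have hT : ∀ φ, J (J.adjoint φ) =ᵐ[volume] fun x => ∫ y, k x y * φ y := fun φ => by
    filter_upwards [coeFn_inclusionL2 hm hb (J.adjoint φ)] with x hx
    rw [hx, adjoint_inclusionL2_apply hH]
  -- The real `sSup` is informative only for a bounded set; an eigenvector gives `l ‖φ‖² = ‖J† φ‖² ≤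
  -- ‖J‖² ‖φ‖²`.
  have hbdd : BddAbove (mercerEigenvalues k) := by
    refine ⟨‖J‖ ^ 2, ?_⟩
    rintro l ⟨φ, hφ, hl⟩
    have heq : J (J.adjoint φ) = l • φ := by
      refine Lp.ext ?_
      filter_upwards [hT φ, hl, Lp.coeFn_smul l φ] with x h1 h2 h3
      rw [h1, h2, h3]
      rfl
    have h1 : ‖J.adjoint φ‖ ^ 2 = l * ‖φ‖ ^ 2 := by
      rw [← real_inner_self_eq_norm_sq, ContinuousLinearMap.adjoint_inner_left, heq,
        inner_smul_right, real_inner_self_eq_norm_sq]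
    have h2 : ‖J.adjoint φ‖ ^ 2 ≤ ‖J‖ ^ 2 * ‖φ‖ ^ 2 := by
      rw [← mul_pow]
      gcongr
      simpa using J.adjoint.le_opNorm φ
    rw [h1] at h2
    exact le_of_mul_le_mul_right h2 (by positivity)
  by_cases h0 : J = 0
  · rw [h0, norm_zero]
    exact Real.sqrt_nonneg _
  -- Finite exponent and countably generated σ-algebra make `L²` separable.
  have : Fact ((2 : ℝ≥0∞) ≠ ∞) := ⟨by simp⟩
  obtain ⟨φ, hφ1, hφ⟩ := exists_norm_attained J.adjoint
    (tendsto_norm_adjoint_inclusionL2 hm hb)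
  have heig := adjoint_comp_self_eq_of_norm_attained J.adjoint hφ1 hφ
  rw [ContinuousLinearMap.adjoint_adjoint, LinearIsometryEquiv.norm_map] at heig
  have hφ0 : φ ≠ 0 := by
    rintro rfl
    rw [map_zero, norm_zero, LinearIsometryEquiv.norm_map] at hφ
    exact h0 (norm_eq_zero.mp hφ.symm)
  refine Real.le_sqrt_of_sq_le (le_csSup hbdd ⟨φ, hφ0, ?_⟩)
  filter_upwards [hT φ, Lp.coeFn_smul (‖J‖ ^ 2) φ] with x h1 h2
  rw [← h1, heig, h2]
  rfl

/-- If the inclusion into `L²` vanishes, then so does the mean embedding. -/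
theorem meanEmbedding_eq_zero_of_inclusionL2_eq_zero (hH : HasKernel H k)
    (hm : ∀ h : H, Measurable h) (hb : ∀ (h : H) x, |h x| ≤ C * ‖h‖)
    (h0 : inclusionL2 hm hb = 0) {f : S → ℝ} (hf : Integrable f) : meanEmbedding H k f = 0 := by
  refine ext_inner_right ℝ fun h => ?_
  rw [inner_meanEmbedding hH hm hb hf, inner_zero_left]
  refine integral_eq_zero_of_ae ?_
  have h1 := coeFn_inclusionL2 hm hb h
  rw [h0, zero_apply] at h1
  filter_upwards [h1, Lp.coeFn_zero ℝ 2 (volume : Measure S)] with x hx hx'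
  rw [← hx, hx']
  simp

end Mercer

/-! ### The weighted space `L²_{1/ρ}` -/

section Weighted

variable {S : Type*} [MeasureSpace S] {ρ : S → ℝ}

theorem invDensityMeasure_absolutelyContinuous : invDensityMeasure ρ ≪ (volume : Measure S) :=
  withDensity_absolutelyContinuous _ _

/-- The weight `1/ρ` never vanishes, since `ENNReal.ofReal` is finite. Hence both measures have the
same null sets, and the same a.e. classes. -/
theorem absolutelyContinuous_invDensityMeasure (hρ : Measurable ρ) :
    (volume : Measure S) ≪ invDensityMeasure ρ :=
  withDensity_absolutelyContinuous' hρ.ennreal_ofReal.inv.aemeasurable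
    (Eventually.of_forall fun x => by simp)

theorem aestronglyMeasurable_of_L2inv (hρ : Measurable ρ) (f : L2inv ρ) :
    AEStronglyMeasurable f (volume : Measure S) :=
  (Lp.aestronglyMeasurable f).mono_ac (absolutelyContinuous_invDensityMeasure hρ)

/-- Cauchy–Schwarz for `|d| = (|d| ρ^{-1/2}) ρ^{1/2}`, with `∫ ρ = 1`. -/
theorem lintegral_enorm_le_eLpNorm_invDensityMeasure (hρ : IsProbDensity ρ) {d : S → ℝ}
    (hd : AEStronglyMeasurable d (volume : Measure S)) :
    ∫⁻ x, ‖d x‖ₑ ≤ eLpNorm d 2 (invDensityMeasure ρ) := by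
  by_cases htop : eLpNorm d 2 (invDensityMeasure ρ) = ∞
  · rw [htop]; exact le_top
  have hw : AEMeasurable (fun x => (ENNReal.ofReal (ρ x))⁻¹) (volume : Measure S) :=
    hρ.measurable.ennreal_ofReal.inv.aemeasurable
  have hnorm : eLpNorm d 2 (invDensityMeasure ρ) =
      (∫⁻ x, (‖d x‖ₑ * (ENNReal.ofReal (ρ x))⁻¹ ^ (1 / 2 : ℝ)) ^ (2 : ℝ)) ^ (1 / 2 : ℝ) := by
    rw [eLpNorm_eq_lintegral_rpow_enorm_toReal (by simp) (by simp), invDensityMeasure,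
      lintegral_withDensity_eq_lintegral_mul₀ hw (by
        exact (hd.enorm.pow_const _))]
    simp only [ENNReal.toReal_ofNat]
    congr 1
    refine lintegral_congr fun x => ?_
    rw [ENNReal.mul_rpow_of_nonneg _ _ (by norm_num), ← ENNReal.rpow_mul]
    norm_num [mul_comm]
  -- Where `ρ = 0` the weight is `∞`, so a finite norm forces `d = 0` a.e. there; this rescues the
  -- factorisation.
  have hfin : ∀ᵐ x, (‖d x‖ₑ * (ENNReal.ofReal (ρ x))⁻¹ ^ (1 / 2 : ℝ)) ^ (2 : ℝ) < ∞ := by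
    refine ae_lt_top' ?_ fun h => htop ?_
    · exact (hd.enorm.mul (hw.pow_const _)).pow_const _
    · rw [hnorm, h]; simp
  calc ∫⁻ x, ‖d x‖ₑ
      ≤ ∫⁻ x, ((fun x => ‖d x‖ₑ * (ENNReal.ofReal (ρ x))⁻¹ ^ (1 / 2 : ℝ)) *
          fun x => ENNReal.ofReal (ρ x) ^ (1 / 2 : ℝ)) x := by
        refine lintegral_mono_ae ?_
        filter_upwards [hfin] with x hx
        simp only [Pi.mul_apply]
        by_cases h0 : ENNReal.ofReal (ρ x) = 0
        · have : ‖d x‖ₑ = 0 := by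
            by_contra hne
            rw [h0] at hx
            simp [ENNReal.mul_top hne] at hx
          simp [this]
        · rw [mul_assoc, ← ENNReal.mul_rpow_of_nonneg _ _ (by norm_num),
            ENNReal.inv_mul_cancel h0 ENNReal.ofReal_ne_top]
          simp
    _ ≤ (∫⁻ x, (‖d x‖ₑ * (ENNReal.ofReal (ρ x))⁻¹ ^ (1 / 2 : ℝ)) ^ (2 : ℝ)) ^ (1 / 2 : ℝ) *
          (∫⁻ x, (ENNReal.ofReal (ρ x) ^ (1 / 2 : ℝ)) ^ (2 : ℝ)) ^ (1 / 2 : ℝ) :=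
        ENNReal.lintegral_mul_le_Lp_mul_Lq volume Real.HolderConjugate.two_two
          (hd.enorm.mul (hw.pow_const _))
          (hρ.measurable.ennreal_ofReal.pow_const _).aemeasurable
    _ = eLpNorm d 2 (invDensityMeasure ρ) := by
        have : ∀ x, (ENNReal.ofReal (ρ x) ^ (1 / 2 : ℝ)) ^ (2 : ℝ) = ENNReal.ofReal (ρ x) :=
          fun x => by rw [← ENNReal.rpow_mul]; norm_num
        simp only [this, hρ.lintegral_eq_one, hnorm]
        simp

/-- As `ρ ≤ K²` a.e., the measure `dx` is at most `K² dx/ρ`. The case `K = ∞` is included, and `K ≠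
0` because `∫ ρ = 1`. -/
theorem eLpNorm_two_le_mul_eLpNorm_invDensityMeasure (hρ : IsProbDensity ρ)
    (d : S → ℝ) :
    eLpNorm d 2 (volume : Measure S) ≤
      eLpNorm (fun y => √(ρ y)) ∞ (volume : Measure S) * eLpNorm d 2 (invDensityMeasure ρ) := by
  set K := eLpNorm (fun y => √(ρ y)) ∞ (volume : Measure S) with hK
  have hle : ∀ᵐ x, ENNReal.ofReal (ρ x) ≤ K ^ 2 := by
    filter_upwards [ae_le_eLpNormEssSup (f := fun y => √(ρ y)) (μ := (volume : Measure S))] with x hx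
    rw [← eLpNorm_exponent_top, ← hK] at hx
    calc ENNReal.ofReal (ρ x) = ‖√(ρ x)‖ₑ ^ 2 := by
          rw [Real.enorm_eq_ofReal (Real.sqrt_nonneg _), ← ENNReal.ofReal_pow (Real.sqrt_nonneg _),
            Real.sq_sqrt (hρ.nonneg x)]
      _ ≤ K ^ 2 := by gcongr
  have hK0 : K ≠ 0 := by
    intro h0
    have : ∫⁻ x, ENNReal.ofReal (ρ x) = 0 := by
      rw [lintegral_eq_zero_iff hρ.measurable.ennreal_ofReal]
      filter_upwards [hle] with x hx
      simpa [h0] using hx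
    rw [hρ.lintegral_eq_one] at this
    exact one_ne_zero this
  have hmeas : (volume : Measure S) ≤ (K ^ 2) • invDensityMeasure ρ := by
    have hs := withDensity_smul (μ := (volume : Measure S)) (K ^ 2)
      hρ.measurable.ennreal_ofReal.inv
    change _ ≤ (K ^ 2) • (volume : Measure S).withDensity (fun x => ENNReal.ofReal (ρ x))⁻¹
    rw [← hs]
    nth_rewrite 1 [← withDensity_one (μ := (volume : Measure S))]
    refine withDensity_mono ?_
    filter_upwards [hle] with x hx
    simp only [Pi.one_apply, Pi.smul_apply, Pi.inv_apply, smul_eq_mul]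
    rw [← div_eq_mul_inv]
    by_cases h0 : ENNReal.ofReal (ρ x) = 0
    · rw [h0, ENNReal.div_zero (pow_ne_zero 2 hK0)]
      exact le_top
    · rw [ENNReal.le_div_iff_mul_le (Or.inl h0) (Or.inl ENNReal.ofReal_ne_top), one_mul]
      exact hx
  calc eLpNorm d 2 (volume : Measure S) ≤ eLpNorm d 2 ((K ^ 2) • invDensityMeasure ρ) :=
        eLpNorm_mono_measure _ hmeas
    _ = K * eLpNorm d 2 (invDensityMeasure ρ) := by
        rw [eLpNorm_smul_measure_of_ne_top (by simp), smul_eq_mul, ← ENNReal.rpow_natCast,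
          ← ENNReal.rpow_mul]
        norm_num

theorem integrable_of_L2inv (hρ : IsProbDensity ρ) (f : L2inv ρ) :
    Integrable f (volume : Measure S) :=
  ⟨aestronglyMeasurable_of_L2inv hρ.measurable f,
    (lintegral_enorm_le_eLpNorm_invDensityMeasure hρ
      (aestronglyMeasurable_of_L2inv hρ.measurable f)).trans_lt (Lp.eLpNorm_lt_top f)⟩

theorem integral_abs_sub_le_dist (hρ : IsProbDensity ρ) (f g : L2inv ρ) :
    ∫ x, |f x - g x| ≤ dist f g := by
  rw [Lp.dist_def]
  have hd := (integrable_of_L2inv hρ f).sub (integrable_of_L2inv hρ g)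
  have h1 : ∫ x, |f x - g x| = (∫⁻ x, ‖(⇑f - ⇑g) x‖ₑ).toReal :=
    integral_norm_eq_lintegral_enorm hd.aestronglyMeasurable
  rw [h1]
  refine ENNReal.toReal_mono ?_
    (lintegral_enorm_le_eLpNorm_invDensityMeasure hρ hd.aestronglyMeasurable)
  exact ((Lp.memLp f).sub (Lp.memLp g)).eLpNorm_ne_top

/-- The inclusion of `L²_{1/ρ}` into `L¹`. -/
noncomputable def toL1OfL2inv (hρ : IsProbDensity ρ) (f : L2inv ρ) : Lp ℝ 1 (volume : Measure S) :=
  (integrable_of_L2inv hρ f).toL1 f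

theorem continuous_toL1OfL2inv (hρ : IsProbDensity ρ) : Continuous (toL1OfL2inv hρ) := by
  refine (LipschitzWith.of_dist_le_mul (K := 1) fun f g => ?_).continuous
  rw [NNReal.coe_one, one_mul, dist_eq_norm, toL1OfL2inv, toL1OfL2inv, ← Integrable.toL1_sub,
    L1.norm_of_fun_eq_integral_norm]
  exact integral_abs_sub_le_dist hρ f g

/-- The classes in `L²_{1/ρ}` that contain a probability density form a closed set. -/
theorem isClosed_setOf_isProbDensity (hρ : IsProbDensity ρ) :
    IsClosed {f : L2inv ρ | ∃ g, IsProbDensity g ∧ f =ᵐ[volume] g} := by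
  -- Membership can be read off in `L¹`, where nonnegativity and unit integral are closed
  -- conditions.
  have heq : {f : L2inv ρ | ∃ g, IsProbDensity g ∧ f =ᵐ[volume] g} =
      toL1OfL2inv hρ ⁻¹' ({h | 0 ≤ h} ∩ {h | ∫ x, h x = 1}) := by
    ext f
    have hcoe : toL1OfL2inv hρ f =ᵐ[volume] f := Integrable.coeFn_toL1 _
    have hnn : 0 ≤ toL1OfL2inv hρ f ↔ 0 ≤ᵐ[volume] f := by
      rw [← Lp.coeFn_nonneg]
      exact ⟨fun h => by filter_upwards [h, hcoe] with x h1 h2; rwa [← h2],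
        fun h => by filter_upwards [h, hcoe] with x h1 h2; rwa [h2]⟩
    change _ ↔ 0 ≤ toL1OfL2inv hρ f ∧ ∫ x, toL1OfL2inv hρ f x = 1
    rw [hnn, integral_congr_ae hcoe]
    constructor
    · rintro ⟨g, hg, hfg⟩
      refine ⟨by filter_upwards [hfg] with x hx; rw [hx]; exact hg.nonneg x, ?_⟩
      rw [integral_congr_ae hfg, integral_eq_lintegral_of_nonneg_ae
        (Eventually.of_forall hg.nonneg) hg.measurable.aestronglyMeasurable, hg.lintegral_eq_one]
      rfl
    · rintro ⟨h0, h1⟩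
      have hsm := aestronglyMeasurable_of_L2inv hρ.measurable f
      -- `IsProbDensity` asks for measurability and nonnegativity everywhere, hence the truncated
      -- measurable representative.
      have hae : f =ᵐ[volume] fun x => max (hsm.mk f x) 0 := by
        filter_upwards [hsm.ae_eq_mk, h0] with x hx hx0
        rw [← hx]
        exact (max_eq_left hx0).symm
      refine ⟨fun x => max (hsm.mk f x) 0, ⟨hsm.stronglyMeasurable_mk.measurable.max
        measurable_const, fun x => le_max_right _ _, ?_⟩, hae⟩
      rw [← lintegral_congr_ae (hae.mono fun x hx => congrArg ENNReal.ofReal hx),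
        ← ofReal_integral_eq_lintegral_ofReal (integrable_of_L2inv hρ f) h0, h1, ENNReal.ofReal_one]
  rw [heq]
  refine IsClosed.preimage (continuous_toL1OfL2inv hρ) (IsClosed.inter isClosed_nonneg ?_)
  exact isClosed_eq continuous_integral continuous_const

variable {H : Type*} [NormedAddCommGroup H] [InnerProductSpace ℝ H]
  [RKHS ℝ H S ℝ] {k : S → S → ℝ} {C : ℝ}

/-- A characteristic kernel separates the classes in `L²_{1/ρ}` of probability densities. -/
theorem IsCharacteristic.injOn (hchar : IsCharacteristic H k) :
    Set.InjOn (fun f : L2inv ρ => meanEmbedding H k f)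
      {f | ∃ g, IsProbDensity g ∧ f =ᵐ[volume] g} := by
  rintro f₁ ⟨g₁, hg₁, h₁⟩ f₂ ⟨g₂, hg₂, h₂⟩ heq
  refine Lp.ext (invDensityMeasure_absolutelyContinuous.ae_eq ?_)
  refine h₁.trans (EventuallyEq.trans (hchar g₁ g₂ hg₁ hg₂ ?_) h₂.symm)
  rw [← meanEmbedding_congr_ae h₁, ← meanEmbedding_congr_ae h₂]
  exact heq

variable [CompleteSpace H]

theorem continuous_meanEmbedding (hρ : IsProbDensity ρ) (hC : 0 ≤ C) (hH : HasKernel H k)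
    (hm : ∀ h : H, Measurable h) (hb : ∀ (h : H) x, |h x| ≤ C * ‖h‖) :
    Continuous fun f : L2inv ρ => meanEmbedding H k f := by
  refine (LipschitzWith.of_dist_le_mul (K := ⟨C, hC⟩) fun f g => ?_).continuous
  rw [dist_eq_norm]
  refine (norm_meanEmbedding_sub_le hC hH hm hb (integrable_of_L2inv hρ f)
    (integrable_of_L2inv hρ g)).trans ?_
  exact mul_le_mul_of_nonneg_left (integral_abs_sub_le_dist hρ f g) hC

/-- The mean embedding contracts `L²_{1/ρ}`-distances by `√λ₀ ‖√ρ‖_∞`. -/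
theorem edist_meanEmbedding_le [IsFiniteMeasure (volume : Measure S)]
    [MeasurableSpace.CountablyGenerated S] (hρ : IsProbDensity ρ) (hH : HasKernel H k)
    (hm : ∀ h : H, Measurable h) (hb : ∀ (h : H) x, |h x| ≤ C * ‖h‖) {f g : S → ℝ}
    (hf : Integrable f) (hg : Integrable g) {ε : ℝ≥0}
    (hε : eLpNorm (fun y => f y - g y) 2 (invDensityMeasure ρ) ≤ ε) :
    edist (meanEmbedding H k f) (meanEmbedding H k g) ≤
      ENNReal.ofReal (√(mercerTop k)) * eLpNorm (fun y => √(ρ y)) ∞ volume * ε := by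
  have hJ := norm_inclusionL2_le hH hm hb
  have hdm : AEStronglyMeasurable (fun y => f y - g y) (volume : Measure S) :=
    (hf.sub hg).aestronglyMeasurable
  -- If a factor `√λ₀` or `ε` is zero, the right side is `0` even when `‖√ρ‖_∞ = ∞`, so the two
  -- embeddings must coincide: either `J = 0` or `f = g` a.e.
  by_cases hA : √(mercerTop k) = 0
  · have h0 : inclusionL2 hm hb = 0 := norm_le_zero_iff.mp (hA ▸ hJ)
    rw [meanEmbedding_eq_zero_of_inclusionL2_eq_zero hH hm hb h0 hf,
      meanEmbedding_eq_zero_of_inclusionL2_eq_zero hH hm hb h0 hg, edist_self]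
    exact zero_le
  by_cases hε0 : ε = 0
  · rw [hε0, ENNReal.coe_zero, nonpos_iff_eq_zero, eLpNorm_eq_zero_iff
      (hdm.mono_ac invDensityMeasure_absolutelyContinuous) two_ne_zero] at hε
    have hfg : f =ᵐ[volume] g := by
      filter_upwards [(absolutelyContinuous_invDensityMeasure hρ.measurable).ae_eq hε] with x hx
      exact sub_eq_zero.mp hx
    rw [meanEmbedding_congr_ae hfg, edist_self]
    exact zero_le
  by_cases hK : eLpNorm (fun y => √(ρ y)) ∞ (volume : Measure S) = ∞
  · have hA' : ENNReal.ofReal (√(mercerTop k)) ≠ 0 := by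
      rw [Ne, ENNReal.ofReal_eq_zero, not_le]
      exact lt_of_le_of_ne (Real.sqrt_nonneg _) (Ne.symm hA)
    rw [hK, ENNReal.mul_top hA', ENNReal.top_mul (by simpa using hε0)]
    exact le_top
  have h2 := (eLpNorm_two_le_mul_eLpNorm_invDensityMeasure hρ (fun y => f y - g y)).trans
    (mul_le_mul_right hε _)
  -- Separately `f` and `g` are only integrable; their difference is in `L²`, which is enough to
  -- apply `J†`.
  have hd2 : MemLp (fun y => f y - g y) 2 (volume : Measure S) :=
    ⟨hdm, h2.trans_lt (ENNReal.mul_lt_top (lt_top_iff_ne_top.mpr hK) ENNReal.coe_lt_top)⟩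
  have hsub : meanEmbedding H k f - meanEmbedding H k g =
      (inclusionL2 hm hb).adjoint (hd2.toLp _) := by
    rw [← meanEmbedding_eq_adjoint_inclusionL2 hH]
    refine ext_inner_right ℝ fun h => ?_
    rw [inner_sub_left, inner_meanEmbedding hH hm hb hf, inner_meanEmbedding hH hm hb hg,
      inner_meanEmbedding (f := fun y => f y - g y) hH hm hb (hf.sub hg),
      ← integral_sub (integrable_apply_mul hm hb hf h) (integrable_apply_mul hm hb hg h)]
    simp only [mul_sub]
  rw [edist_eq_enorm_sub, hsub, mul_assoc]
  calc ‖(inclusionL2 hm hb).adjoint (hd2.toLp _)‖ₑ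
      ≤ ‖(inclusionL2 hm hb).adjoint‖ₑ * ‖hd2.toLp _‖ₑ := ContinuousLinearMap.le_opENorm _ _
    _ ≤ _ := by
      refine mul_le_mul' ?_ ?_
      · rw [← ofReal_norm, LinearIsometryEquiv.norm_map]
        exact ENNReal.ofReal_le_ofReal hJ
      · rw [Lp.enorm_toLp]
        exact h2

end Weighted

/-! ### Images of manifolds -/

section Manifolds

variable {E F : Type*} [TopologicalSpace E] [TopologicalSpace F] {A : Set E} {B : Set F}

theorem IsManifoldOfDim.of_homeomorph {r : ℕ} (h : IsManifoldOfDim r A) (e : A ≃ₜ B) :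
    IsManifoldOfDim r B := by
  obtain ⟨_, _, ⟨c⟩⟩ := h
  exact ⟨e.t2Space, e.symm.isEmbedding.secondCountableTopology, ⟨e.chartedSpace⟩⟩

theorem IsBoundarylessManifoldOfDim.of_homeomorph {r : ℕ} (h : IsBoundarylessManifoldOfDim r A)
    (e : A ≃ₜ B) : IsBoundarylessManifoldOfDim r B := by
  obtain ⟨_, _, ⟨c⟩⟩ := h
  exact ⟨e.t2Space, e.symm.isEmbedding.secondCountableTopology, ⟨e.chartedSpace⟩⟩

/-- A continuous map that is injective on a compact set restricts to homeomorphisms of its subsets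
onto their images. -/
theorem nonempty_homeomorph_image [T2Space F] {K : Set E} (hK : IsCompact K) (hA : A ⊆ K)
    {Φ : E → F} (hΦ : Continuous Φ) (hinj : Set.InjOn Φ K) : Nonempty (A ≃ₜ Φ '' A) := by
  have : CompactSpace K := isCompact_iff_compactSpace.mp hK
  have hemb : IsEmbedding (K.domRestrict Φ) :=
    ((hΦ.comp continuous_subtype_val).isClosedEmbedding
      (Set.injOn_iff_injective.mp hinj)).isEmbedding
  have hemb' : IsEmbedding (A.domRestrict Φ) := hemb.comp (IsEmbedding.inclusion hA)
  exact ⟨hemb'.toHomeomorph.trans (Homeomorph.setCongr (Set.range_domRestrict Φ A))⟩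

end Manifolds

/-- Transition densities are probability densities. -/
theorem HasTransitionDensity.isProbDensity {S : Type*} [MeasureSpace S] {Ω : Type*}
    [MeasurableSpace Ω] {P : MarkovProcess S Ω} {p : ℝ≥0 → S → S → ℝ}
    (hp : HasTransitionDensity P p) {t : ℝ≥0} (ht : 0 < t) (x : S) : IsProbDensity (p t x) := by
  obtain ⟨hm, h0, hlaw⟩ := hp t ht x
  refine ⟨hm, h0, ?_⟩
  have := P.isMarkovKernel_law
  have h1 := congrArg (fun ν : Measure S => ν Set.univ) hlaw
  simp only [densityMeasure] at h1
  rw [Measure.map_apply (P.measurable_path t) MeasurableSet.univ, Set.preimage_univ, measure_univ,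
    withDensity_apply _ MeasurableSet.univ, Measure.restrict_univ] at h1
  exact h1.symm

theorem IsProbDensity.integrable {S : Type*} [MeasureSpace S] {f : S → ℝ} (hf : IsProbDensity f) :
    Integrable f (volume : Measure S) := by
  refine ⟨hf.measurable.aestronglyMeasurable, ?_⟩
  rw [hasFiniteIntegral_iff_ofReal (Eventually.of_forall hf.nonneg), hf.lintegral_eq_one]
  exact ENNReal.one_lt_top

end TransitionManifold


theorem mainTheorem1 {n : ℕ} (X : Set (EuclideanSpace ℝ (Fin n))) (hX : IsCompact X)
    -- the process, its invariant density and its transition densities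
    {Ω : Type*} [MeasurableSpace Ω] (P : MarkovProcess X Ω)
    (ρ : X → ℝ) (hρ : IsReversibleWithUniqueDensity P ρ)
    (p : ℝ≥0 → X → X → ℝ) (hp : HasTransitionDensity P p)
    -- the kernel and its reproducing kernel Hilbert space
    (k : X → X → ℝ) (hk : IsPosDefKernel k) (hkm : Measurable (Function.uncurry k))
    (hkb : ∃ C, ∀ x, k x x ≤ C)
    {H : Type*} [NormedAddCommGroup H] [InnerProductSpace ℝ H] [CompleteSpace H]
    [RKHS ℝ H X ℝ] (hH : HasKernel H k) (hchar : IsCharacteristic H k)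
    -- reducibility
    (τ : ℝ≥0) (hτ : 0 < τ) (ε : ℝ≥0) (r : ℕ) (hred : IsReducible ρ p τ ε r) :
    ∀ M : Set (L2inv ρ), IsTransitionManifold ρ p τ ε r M →
      (IsCompact (closure M) →
        IsManifoldOfDim r ((fun f : L2inv ρ => meanEmbedding H k f) '' M) ∧
        (IsBoundarylessManifoldOfDim r M →
          IsBoundarylessManifoldOfDim r ((fun f : L2inv ρ => meanEmbedding H k f) '' M))) ∧
      ∀ x : X,
        Metric.infEDist (meanEmbedding H k (p τ x))
            ((fun f : L2inv ρ => meanEmbedding H k f) '' M) ≤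
          ENNReal.ofReal (Real.sqrt (mercerTop k)) *
            eLpNorm (fun y => Real.sqrt (ρ y)) ∞ volume * ε := by
  have hρd : IsProbDensity ρ := hρ.invariant.1
  obtain ⟨C, hC⟩ := hkb
  have hm : ∀ h : H, Measurable h := hH.measurable fun x => hkm.comp measurable_prodMk_left
  have hb : ∀ (h : H) x, |h x| ≤ √C * ‖h‖ := hH.abs_apply_le hC
  have : IsFiniteMeasure (volume : Measure X) := by
    refine ⟨?_⟩
    rw [Measure.Subtype.volume_univ hX.measurableSet.nullMeasurableSet]
    exact hX.measure_lt_top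
  intro M hM
  refine ⟨fun hcomp => ?_, fun x => ?_⟩
  · have hsub : closure M ⊆ {f : L2inv ρ | ∃ g, IsProbDensity g ∧ f =ᵐ[volume] g} := by
      refine closure_minimal (fun f hf => ?_) (isClosed_setOf_isProbDensity hρd)
      obtain ⟨x, hx⟩ := hM.subset hf
      exact ⟨p τ x, hp.isProbDensity hτ x, hx⟩
    obtain ⟨e⟩ := nonempty_homeomorph_image hcomp subset_closure
      (continuous_meanEmbedding hρd (Real.sqrt_nonneg C) hH hm hb) (hchar.injOn.mono hsub)
    exact ⟨hM.isManifold.of_homeomorph e, fun h => h.of_homeomorph e⟩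
  · obtain ⟨f, hf, hfε⟩ := hM.close x
    refine (Metric.infEDist_le_edist_of_mem (Set.mem_image_of_mem _ hf)).trans ?_
    rw [edist_comm]
    exact edist_meanEmbedding_le hρd hH hm hb (integrable_of_L2inv hρd f)
      (hp.isProbDensity hτ x).integrable hfε
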